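/- Let $\mathcal X,\mathcal Z$ be measurable spaces, $P_{Z|X}$ a Markov kernel from $\mathcal X$ to $\mathcal Z$, $Q$ a probability distribution on $\mathcal Z$, and $\alpha\in(1,\infty]$. Let $X$ be an $\mathcal X$-valued random variable (of arbitrary law, possibly deterministic) such that $P_{Z|X}(\cdot|X)\ll Q$ almost surely. Let $Z_1,Z_2,\ldots$ be i.i.d. with law $Q$, and let $T_1<T_2<\cdots$ be the arrival times of a rate-one Poisson process, i.e. $T_1,T_2-T_1,T_3-T_2,\ldots$ are i.i.d. $\mathrm{Exp}(1)$; assume that $X$, $(Z_i)_i$ and $(T_i)_i$ are independent. Let $f(x,z)$ be any jointly measurable version of the density $\frac{\mathrm dP_{Z|X}(\cdot|x)}{\mathrm dQ}(z)$ (i.e. almost surely, $f(X,\cdot)$ agrees $Q$-almost everywhere with the density of $P_{Z|X}(\cdot|X)$ with respect to $Q$), and put $\tilde T_i:=T_i\, f(X,Z_i)^{-1}$, with $\tilde T_i:=\infty$ if $f(X,Z_i)=0$. The Poisson private representation (PPR) with parameter $\alpha$ works as follows. If $\alpha<\infty$, the encoder, given $X$, $(Z_i)_i$ and $(T_i)_i$,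 draws a random index $K\in\{1,2,\ldots\}$ with conditional probabilities $$\Pr\big(K=k\,\big|\,X,(Z_i)_i,(T_i)_i\big)=\frac{\tilde T_k^{-\alpha}}{\sum_{i=1}^\infty\tilde T_i^{-\alpha}},\qquad k=1,2,\ldots,$$ where $\infty^{-\alpha}=0$; if $\alpha=\infty$, then $K=\mathrm{argmin}_i\,\tilde T_i$ almost surely. The decoder, which knows $(Z_i)_i$ and $K$, outputs $Z_K$. Then this selection rule is almost surely well defined: $0<\sum_{i}\tilde T_i^{-\alpha}<\infty$ almost surely if $\alpha<\infty$, and $(\tilde T_i)_i$ almost surely has a unique minimizer if $\alpha=\infty$. Moreover, PPR simulates the mechanism exactly: for every random index $K$ generated in this way, the conditional distribution of the output $Z_K$ given $X$ is $P_{Z|X}$, that is, the joint law of $(X,Z_K)$ is $P_X(\mathrm dx)\,P_{Z|X}(\mathrm dz|x)$, where $P_X$ is the law of $X$. In particular, if the input is deterministic, $X=x$ almost surely, then $Z_K\sim P_{Z|X}(\cdot|x)$. -/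

import Mathlib

open MeasureTheory ProbabilityTheory
open scoped ENNReal

namespace PPR

/-- The gaps `T₁, T₂ - T₁, T₃ - T₂, …` of a sequence of arrival times. Sequences are indexed by
`ℕ` starting from `0`, so that `T 0` is the first arrival time. -/
def gap {Ω : Type*} (T : ℕ → Ω → ℝ) : ℕ → Ω → ℝ
  | 0 => T 0
  | n + 1 => fun ω => T (n + 1) ω - T n ω

/-- `T` is the sequence of arrival times of a Poisson process of rate one on `[0, ∞)`:
the first arrival time and the later gaps are i.i.d. exponential with parameter one. -/
structure IsUnitPoissonProcess {Ω : Type*} [MeasurableSpace Ω] (T : ℕ → Ω → ℝ) (μ : Measure Ω) :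
    Prop where
  measurable : ∀ i, Measurable (T i)
  indep : iIndepFun (gap T) μ
  law : ∀ i, HasLaw (gap T i) (expMeasure 1) μ

/-- `Z` is a sequence of i.i.d. samples from `Q`. -/
structure IsIIDSample {Ω 𝒵 : Type*} [MeasurableSpace Ω] [MeasurableSpace 𝒵]
    (Z : ℕ → Ω → 𝒵) (Q : Measure 𝒵) (μ : Measure Ω) : Prop where
  measurable : ∀ i, Measurable (Z i)
  indep : iIndepFun Z μ
  law : ∀ i, HasLaw (Z i) Q μ

/-- The scaled time `t * r⁻¹`, taken to be `∞` when the density value `r` is `0`. -/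
noncomputable def scaledTime (t r : ℝ≥0∞) : ℝ≥0∞ :=
  if r = 0 then ∞ else t * r⁻¹

/-- The normalizing constant `∑ i, τ i ^ (-a)` (where `∞ ^ (-a) = 0` for `a > 0`). -/
noncomputable def normalizer (a : ℝ) (τ : ℕ → ℝ≥0∞) : ℝ≥0∞ :=
  ∑' i, τ i ^ (-a)

/-- The selection probability `τ k ^ (-a) / ∑ i, τ i ^ (-a)` of the index `k`. -/
noncomputable def selectionProb (a : ℝ) (τ : ℕ → ℝ≥0∞) (k : ℕ) : ℝ≥0∞ :=
  τ k ^ (-a) / normalizer a τ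

/-- Minimizers (`argmin`) of a sequence. -/
def IsArgmin (τ : ℕ → ℝ≥0∞) (k : ℕ) : Prop :=
  ∀ i, τ k ≤ τ i

/-- `K` is an index selected with parameter `α` from the scaled times `τ`, given the data `D` that
the encoder holds. For finite `α`, the conditional probability of `K = k` given `D` is the selection
probability of `k`; for `α = ∞`, the index `K` is almost surely a minimizer. -/
structure IsSelectedIndex {Ω 𝒟 : Type*} [MeasurableSpace Ω] [MeasurableSpace 𝒟]
    (α : ℝ≥0∞) (D : Ω → 𝒟) (τ : Ω → ℕ → ℝ≥0∞) (K : Ω → ℕ) (μ : Measure Ω) : Prop where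
  measurable : Measurable K
  finite_rule : α ≠ ∞ → ∀ k : ℕ,
    μ⟦K ⁻¹' {k} | MeasurableSpace.comap D inferInstance⟧
      =ᵐ[μ] fun ω => (selectionProb α.toReal (τ ω) k).toReal
  top_rule : α = ∞ → ∀ᵐ ω ∂μ, IsArgmin (τ ω) (K ω)

/-- The random inputs of Poisson private representation: the data `X`, the shared randomness `Z`
(i.i.d. samples from `Q`) and the Poisson process `T` generated by the encoder, with `X`, `Z`, `T`
independent. The law of `X` is arbitrary; a deterministic input is a constant `X`. -/
structure IsSource {Ω 𝒳 𝒵 : Type*} [MeasurableSpace Ω] [MeasurableSpace 𝒳] [MeasurableSpace 𝒵]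
    (Q : Measure 𝒵) (X : Ω → 𝒳) (Z : ℕ → Ω → 𝒵) (T : ℕ → Ω → ℝ) (μ : Measure Ω) : Prop where
  measurable_data : Measurable X
  sample : IsIIDSample Z Q μ
  poisson : IsUnitPoissonProcess T μ
  indep_data_sample : IndepFun X (fun ω i => Z i ω) μ
  indep_poisson : IndepFun (fun ω => (X ω, fun i => Z i ω)) (fun ω i => T i ω) μ

/-- The scaled times `T i * (f (X) (Z i))⁻¹` computed by the encoder, where `f x` is a density of the
simulated distribution at the input `x` with respect to the proposal distribution. -/
noncomputable def scaledTimes {Ω 𝒳 𝒵 : Type*} (f : 𝒳 → 𝒵 → ℝ≥0∞) (X : Ω → 𝒳) (Z : ℕ → Ω → 𝒵)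
    (T : ℕ → Ω → ℝ) (ω : Ω) (i : ℕ) : ℝ≥0∞ :=
  scaledTime (ENNReal.ofReal (T i ω)) (f (X ω) (Z i ω))

/-- All that the encoder knows when it draws the index: the data, the shared randomness and the
Poisson process. -/
def encoderData {Ω 𝒳 𝒵 : Type*} (X : Ω → 𝒳) (Z : ℕ → Ω → 𝒵) (T : ℕ → Ω → ℝ) (ω : Ω) :
    𝒳 × (ℕ → 𝒵) × (ℕ → ℝ) :=
  (X ω, (fun i => Z i ω), (fun i => T i ω))

/-- The output of the decoder, which knows the shared randomness and the index. -/
def decoderOutput {Ω 𝒵 : Type*} (Z : ℕ → Ω → 𝒵) (K : Ω → ℕ) (ω : Ω) : 𝒵 :=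
  Z (K ω) ω

end PPR

/-! For a fixed input with density `f`, the pairs (arrival time, mark) form a Poisson process of
intensity dt × Q. Dividing each time by the density at its mark turns this into intensity ds × f Q,
where f Q is the target law. Mecke's formula for the scaled process (`lintegral_tsum_tau`) says that
the expected sum over points of G(mark) · r(scaled time, remaining points) equals (∫ G f dQ) · C,
with C depending on r but not on G. Both selection rules have this form: the probability of
selecting a point depends only on its own scaled time and on the remaining points. Taking G = 1
identifies C with the expected total selection probability, which is 1; hence the selected mark has
law f Q. Mecke's formula is proved from the gaps: deleting arrival k merges two exponential gaps,
and conversely Lebesgue measure on one exponential gap places a point that splits it into two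
independent exponential gaps (`lintegral_expMeasure_split`). The same formula shows that the rules
are well defined. A random input is then frozen, by independence. -/

namespace PPR

/-! ### Inserting and resampling one term of an i.i.d. sequence -/

/-- The index map that skips the value `k`. -/
def skip (k j : ℕ) : ℕ := if j < k then j else j + 1

/-- Insert the term `e` at position `k` of the sequence `w`. -/
def insertAt {E : Type*} (k : ℕ) (e : E) (w : ℕ → E) (i : ℕ) : E :=
  if i < k then w i else if i = k then e else w (i - 1)

theorem skip_ne (k j : ℕ) : skip k j ≠ k := by
  unfold skip; split_ifs <;> omega

theorem skip_injective (k : ℕ) : Function.Injective (skip k) := by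
  intro i j h
  unfold skip at h
  split_ifs at h <;> omega

theorem exists_skip_eq {k i : ℕ} (h : i ≠ k) : ∃ j, skip k j = i := by
  rcases lt_or_gt_of_ne h with h | h
  · exact ⟨i, by simp [skip, h]⟩
  · refine ⟨i - 1, ?_⟩
    unfold skip
    split_ifs <;> omega

@[simp]
theorem insertAt_self {E : Type*} (k : ℕ) (e : E) (w : ℕ → E) : insertAt k e w k = e := by
  simp [insertAt]

@[simp]
theorem insertAt_skip {E : Type*} (k : ℕ) (e : E) (w : ℕ → E) (j : ℕ) :
    insertAt k e w (skip k j) = w j := by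
  unfold insertAt skip
  split_ifs <;> first | rfl | omega

theorem measurable_insertAt {E : Type*} [MeasurableSpace E] (k : ℕ) :
    Measurable fun p : E × (ℕ → E) => insertAt k p.1 p.2 := by
  refine measurable_pi_iff.2 fun i => ?_
  unfold insertAt
  split_ifs <;> fun_prop

/-- Infinite product measures are determined by finite cylinders. The preimage of a cylinder under
insertion is a rectangle, one side constraining the inserted term and the other the remaining ones,
so its mass is the same product with the factor at `k` taken out. -/
theorem map_insertAt {E : Type*} [MeasurableSpace E] (ν : Measure E) [IsProbabilityMeasure ν]
    (k : ℕ) :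
    (ν.prod (Measure.infinitePi fun _ : ℕ => ν)).map (fun p => insertAt k p.1 p.2) =
      Measure.infinitePi fun _ : ℕ => ν := by
  refine Measure.eq_infinitePi _ fun s t ht => ?_
  rw [Measure.map_apply (measurable_insertAt k)
    (MeasurableSet.pi s.countable_toSet fun i _ => ht i)]
  have hpre : (fun p : E × (ℕ → E) => insertAt k p.1 p.2) ⁻¹' (s : Set ℕ).pi t =
      {e | k ∈ s → e ∈ t k} ×ˢ
        ((s.preimage (skip k) (skip_injective k).injOn : Finset ℕ) : Set ℕ).pi
          (fun j => t (skip k j)) := by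
    ext ⟨e, w⟩
    simp only [Set.mem_preimage, Set.mem_pi, Finset.mem_coe, Set.mem_prod, Set.mem_ofPred_eq,
      Finset.mem_preimage]
    constructor
    · intro h
      exact ⟨fun hk => by simpa using h k hk, fun j hj => by simpa using h _ hj⟩
    · rintro ⟨h₁, h₂⟩ i hi
      by_cases hik : i = k
      · subst hik; simpa using h₁ hi
      · obtain ⟨j, rfl⟩ := exists_skip_eq hik
        simpa using h₂ j hi
  have hprod : ∏ j ∈ s.preimage (skip k) (skip_injective k).injOn, ν (t (skip k j)) =
      ∏ i ∈ s.erase k, ν (t i) := by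
    classical
    rw [Finset.prod_preimage' (skip k) s (skip_injective k).injOn fun i => ν (t i)]
    refine Finset.prod_congr ?_ fun _ _ => rfl
    ext i
    simp only [Finset.mem_filter, Set.mem_range, Finset.mem_erase]
    constructor
    · rintro ⟨hi, j, rfl⟩; exact ⟨skip_ne k j, hi⟩
    · rintro ⟨hik, hi⟩; exact ⟨hi, exists_skip_eq hik⟩
  rw [hpre, Measure.prod_prod, Measure.infinitePi_pi _ fun j _ => ht _, hprod]
  by_cases hk : k ∈ s
  · simp only [hk, forall_const, Set.ofPred_mem_eq]
    exact Finset.mul_prod_erase s (fun i => ν (t i)) hk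
  · simp [hk]

theorem lintegral_insertAt {E : Type*} [MeasurableSpace E] (ν : Measure E)
    [IsProbabilityMeasure ν] (k : ℕ) {F : (ℕ → E) → ℝ≥0∞} (hF : Measurable F) :
    ∫⁻ w, F w ∂(Measure.infinitePi fun _ : ℕ => ν) =
      ∫⁻ e, ∫⁻ w, F (insertAt k e w) ∂(Measure.infinitePi fun _ : ℕ => ν) ∂ν := by
  conv_lhs => rw [← map_insertAt ν k]
  rw [lintegral_map hF (measurable_insertAt k),
    lintegral_prod (fun p : E × (ℕ → E) => F (insertAt k p.1 p.2))
      (hF.comp (measurable_insertAt k)).aemeasurable]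

theorem update_insertAt {E : Type*} (k : ℕ) (e e' : E) (w : ℕ → E) :
    Function.update (insertAt k e w) k e' = insertAt k e' w := by
  ext i
  by_cases h : i = k
  · subst h; simp
  · simp [insertAt, h]

theorem measurable_update_prod {E : Type*} [MeasurableSpace E] (k : ℕ) :
    Measurable fun p : (ℕ → E) × E => Function.update p.1 k p.2 := by
  refine measurable_pi_iff.2 fun i => ?_
  by_cases h : i = k
  · subst h; simpa using measurable_snd
  · simp only [Function.update_of_ne h]
    fun_prop

/-- Resampling one term of an i.i.d. sequence does not change its law. -/
theorem lintegral_update {E : Type*} [MeasurableSpace E] (ν : Measure E)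
    [IsProbabilityMeasure ν] (k : ℕ) {F : (ℕ → E) → ℝ≥0∞} (hF : Measurable F) :
    ∫⁻ w, F w ∂(Measure.infinitePi fun _ : ℕ => ν) =
      ∫⁻ w, ∫⁻ e, F (Function.update w k e) ∂ν ∂(Measure.infinitePi fun _ : ℕ => ν) := by
  have hm : Measurable fun w : ℕ → E => ∫⁻ e, F (Function.update w k e) ∂ν :=
    (hF.comp (measurable_update_prod k)).lintegral_prod_right'
  rw [lintegral_insertAt ν k hm]
  simp only [update_insertAt]
  -- Resampling overwrites the inserted term, so the outer integrand is constant in it and only the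
  -- order of the two remaining integrals differs.
  rw [lintegral_const, measure_univ, mul_one, lintegral_insertAt ν k hF,
    lintegral_lintegral_swap]
  exact (hF.comp (measurable_insertAt k)).aemeasurable

/-! ### Gaps of the Poisson process and Mecke's formula -/

/-- The sum of the first `n` gaps. -/
def gapSum (g : ℕ → ℝ) (n : ℕ) : ℝ := ∑ i ∈ Finset.range n, g i

/-- The gaps that remain when the arrival with index `k` is removed. -/
def mergeGap (k : ℕ) (g : ℕ → ℝ) (i : ℕ) : ℝ :=
  if i < k then g i else if i = k then g k + g (k + 1) else g (i + 1)

@[fun_prop]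
theorem measurable_gapSum (n : ℕ) : Measurable fun g => gapSum g n := by
  unfold gapSum; fun_prop

@[fun_prop]
theorem measurable_mergeGap (k : ℕ) : Measurable (mergeGap k) := by
  refine measurable_pi_iff.2 fun i => ?_
  unfold mergeGap
  split_ifs <;> fun_prop

theorem gapSum_succ (g : ℕ → ℝ) (n : ℕ) : gapSum g (n + 1) = gapSum g n + g n :=
  Finset.sum_range_succ _ _

theorem gapSum_congr {g g' : ℕ → ℝ} {n : ℕ} (h : ∀ i < n, g i = g' i) : gapSum g n = gapSum g' n :=
  Finset.sum_congr rfl fun i hi => h i (Finset.mem_range.1 hi)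

theorem gapSum_insertAt (k : ℕ) (a : ℝ) (g : ℕ → ℝ) :
    gapSum (insertAt k a g) (k + 1) = gapSum g k + a := by
  rw [gapSum_succ, insertAt_self, gapSum_congr (g' := g)]
  intro i hi
  simp [insertAt, hi]

theorem gapSum_update (k : ℕ) (a : ℝ) (g : ℕ → ℝ) :
    gapSum (Function.update g k a) k = gapSum g k :=
  gapSum_congr fun i hi => by rw [Function.update_of_ne hi.ne]

theorem mergeGap_insertAt (k : ℕ) (a : ℝ) (g : ℕ → ℝ) :
    mergeGap k (insertAt k a g) = Function.update g k (a + g k) := by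
  ext i
  rcases lt_trichotomy i k with h | h | h
  · simp [mergeGap, insertAt, h, h.ne]
  · subst h; simp [mergeGap, insertAt]
  · have h1 : ¬ i < k := by omega
    have h2 : i ≠ k := by omega
    have h3 : ¬ i + 1 < k := by omega
    have h4 : i + 1 ≠ k := by omega
    simp [mergeGap, insertAt, h1, h2, h3, h4]

/-- Merging two adjacent gaps erases one partial sum and keeps all others. The arrival with index
`i` is `gapSum g (i + 1)`, which explains the shifts. -/
theorem gapSum_mergeGap (k : ℕ) (g : ℕ → ℝ) (i : ℕ) :
    gapSum (mergeGap k g) (i + 1) = gapSum g (skip k i + 1) := by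
  induction i with
  | zero =>
    rcases Nat.eq_zero_or_pos k with h | h
    · subst h; simp [gapSum, mergeGap, skip, Finset.sum_range_succ]
    · simp [gapSum, mergeGap, skip, h]
  | succ n ih =>
    rw [gapSum_succ, ih]
    rcases lt_trichotomy (n + 1) k with h | h | h
    · have : n < k := by omega
      simp [skip, mergeGap, h, this, gapSum_succ]
    · have : n < k := by omega
      subst h
      simp [skip, mergeGap, gapSum_succ, add_assoc]
    · have h1 : ¬ n < k := by omega
      have h2 : ¬ n + 1 < k := by omega
      have h3 : n + 1 ≠ k := by omega
      simp [skip, mergeGap, gapSum_succ, h1, h2, h3]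

instance : IsProbabilityMeasure (expMeasure 1) := isProbabilityMeasure_expMeasure one_pos

theorem lintegral_expMeasure_one {F : ℝ → ℝ≥0∞} (hF : Measurable F) :
    ∫⁻ x, F x ∂(expMeasure 1) = ∫⁻ x in Set.Ioi 0, ENNReal.ofReal (Real.exp (-x)) * F x := by
  have hpdf : gammaPDF 1 1 = exponentialPDF 1 := rfl
  have hm : Measurable (exponentialPDF 1) := (measurable_exponentialPDFReal 1).ennreal_ofReal
  rw [expMeasure, gammaMeasure, hpdf, lintegral_withDensity_eq_lintegral_mul _ hm hF,
    ← lintegral_indicator measurableSet_Ioi]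
  refine lintegral_congr_ae ?_
  filter_upwards [Measure.ae_ne volume (0 : ℝ)] with x hx
  rcases lt_or_gt_of_ne hx with h | h
  · simp [exponentialPDF_of_neg h, Set.indicator_of_notMem, h.le]
  · simp [exponentialPDF_of_nonneg h.le, Set.indicator_of_mem, h]

/-- A uniform point in an interval of exponential length (with the size of the interval as weight)
splits it into two independent exponential intervals. -/
theorem lintegral_expMeasure_split {h : ℝ × ℝ → ℝ≥0∞} (hh : Measurable h) :
    ∫⁻ a, ∫⁻ b, h (a, a + b) ∂(expMeasure 1) ∂(expMeasure 1) =
      ∫⁻ c, (∫⁻ t in Set.Ioc 0 c, h (t, c)) ∂(expMeasure 1) := by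
  -- With c = a + b, the joint density exp(-a) exp(-b) equals exp(-c) on 0 < a < c, so it does not
  -- depend on a. Both sides are iterated integrals of this `Φ`.
  set Φ : ℝ → ℝ → ℝ≥0∞ := fun a c =>
    (Set.Ioi 0).indicator 1 a * ((Set.Ioi 0).indicator 1 (c - a) *
      (ENNReal.ofReal (Real.exp (-c)) * h (a, c))) with hΦ
  have hone : Measurable ((Set.Ioi (0 : ℝ)).indicator (1 : ℝ → ℝ≥0∞)) :=
    measurable_one.indicator measurableSet_Ioi
  have hΦm : Measurable (Function.uncurry Φ) := by
    simp only [hΦ, Function.uncurry_def]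
    fun_prop
  have hL : ∫⁻ a, ∫⁻ b, h (a, a + b) ∂(expMeasure 1) ∂(expMeasure 1) = ∫⁻ a, ∫⁻ c, Φ a c := by
    rw [lintegral_expMeasure_one (by
      exact Measurable.lintegral_prod_right' (f := fun p : ℝ × ℝ => h (p.1, p.1 + p.2))
        (by fun_prop)), ← lintegral_indicator measurableSet_Ioi]
    refine lintegral_congr fun a => ?_
    by_cases ha : 0 < a
    · rw [Set.indicator_of_mem (by exact ha), lintegral_expMeasure_one (by fun_prop),
        ← lintegral_indicator measurableSet_Ioi, ← lintegral_const_mul _ (by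
          refine Measurable.indicator ?_ measurableSet_Ioi; fun_prop),
        ← lintegral_add_left_eq_self (fun c => Φ a c) a]
      refine lintegral_congr fun b => ?_
      by_cases hb : 0 < b
      · simp only [hΦ, Set.indicator, Set.mem_Ioi, ha, hb, if_true, add_sub_cancel_left,
          Pi.one_apply, one_mul, neg_add, Real.exp_add, ENNReal.ofReal_mul (Real.exp_pos _).le,
          mul_assoc]
      · simp [hΦ, hb]
    · simp [hΦ, ha]
  have hR : ∫⁻ c, (∫⁻ t in Set.Ioc 0 c, h (t, c)) ∂(expMeasure 1) = ∫⁻ c, ∫⁻ a, Φ a c := by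
    have hinner : ∀ c, ∫⁻ t in Set.Ioc 0 c, h (t, c) =
        ∫⁻ t, (Set.Ioi 0).indicator 1 t * ((Set.Ioi 0).indicator 1 (c - t) * h (t, c)) := by
      intro c
      rw [setLIntegral_congr Ioo_ae_eq_Ioc.symm, ← lintegral_indicator measurableSet_Ioo]
      refine lintegral_congr fun t => ?_
      by_cases h0 : 0 < t <;> by_cases h1 : t < c <;> simp [h0, h1]
    simp only [hinner]
    rw [lintegral_expMeasure_one (by
      exact Measurable.lintegral_prod_right' (f := fun p : ℝ × ℝ =>
        (Set.Ioi (0 : ℝ)).indicator 1 p.2 * ((Set.Ioi (0 : ℝ)).indicator 1 (p.1 - p.2) * h (p.2, p.1))) (by fun_prop)),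
      ← lintegral_indicator measurableSet_Ioi]
    refine lintegral_congr fun c => ?_
    by_cases hc : 0 < c
    · rw [Set.indicator_of_mem (by exact hc), ← lintegral_const_mul _ (by fun_prop)]
      refine lintegral_congr fun t => ?_
      simp only [hΦ]
      ring
    · rw [Set.indicator_of_notMem (by exact hc)]
      symm
      rw [lintegral_eq_zero_iff (by fun_prop)]
      refine Filter.Eventually.of_forall fun t => ?_
      by_cases ht : 0 < t
      · have : ¬ t < c := by linarith
        simp [hΦ, this]
      · simp [hΦ, ht]
  rw [hL, hR, lintegral_lintegral_swap hΦm.aemeasurable]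

/-- The law of the gaps of a Poisson process of rate one. -/
noncomputable def gapLaw : Measure (ℕ → ℝ) := Measure.infinitePi fun _ : ℕ => expMeasure 1

instance : IsProbabilityMeasure gapLaw := by unfold gapLaw; infer_instance

theorem ae_expMeasure_one_pos : ∀ᵐ x ∂(expMeasure 1), 0 < x := by
  have h := lintegral_expMeasure_one (F := (Set.Iic 0).indicator 1)
    (measurable_one.indicator measurableSet_Iic)
  rw [lintegral_indicator_one measurableSet_Iic] at h
  rw [ae_iff]
  simp only [not_lt]
  refine h.trans ?_
  rw [setLIntegral_congr_fun (g := fun _ => 0) measurableSet_Ioi fun x hx => by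
    simp [not_le.2 (Set.mem_Ioi.1 hx)]]
  simp

theorem ae_gapLaw_pos : ∀ᵐ g ∂gapLaw, ∀ i, 0 < g i := by
  refine ae_all_iff.2 fun i => ?_
  exact (measurePreserving_eval_infinitePi (fun _ : ℕ => expMeasure 1) i).quasiMeasurePreserving.ae
    ae_expMeasure_one_pos

/-- The strong law applied to gaps truncated to [0, 1], which are bounded with positive mean; the
partial sums of the gaps dominate those of the truncations. -/
theorem ae_gapLaw_tendsto :
    ∀ᵐ g ∂gapLaw, Filter.Tendsto (gapSum g) Filter.atTop Filter.atTop := by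
  set Y : ℕ → (ℕ → ℝ) → ℝ := fun i g => min 1 (max 0 (g i)) with hY
  have hYm : ∀ i, Measurable (Y i) := fun i => by simp only [hY]; fun_prop
  have hY0 : ∀ i g, 0 ≤ Y i g := fun i g => le_min zero_le_one (le_max_left _ _)
  have hint : Integrable (Y 0) gapLaw :=
    Integrable.of_bound (hYm 0).aestronglyMeasurable 1 (Filter.Eventually.of_forall fun g => by
      rw [Real.norm_of_nonneg (hY0 0 g)]; exact min_le_left _ _)
  have hindep : iIndepFun Y gapLaw :=
    iIndepFun_infinitePi (P := fun _ : ℕ => expMeasure 1) (X := fun _ x => min 1 (max 0 x))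
      fun _ => by fun_prop
  have hident : ∀ i, IdentDistrib (Y i) (Y 0) gapLaw gapLaw := by
    intro i
    have h : IdentDistrib (fun g : ℕ → ℝ => g i) (fun g => g 0) gapLaw gapLaw :=
      ⟨(measurable_pi_apply i).aemeasurable, (measurable_pi_apply 0).aemeasurable,
        (Measure.infinitePi_map_eval (fun _ : ℕ => expMeasure 1) i).trans
          (Measure.infinitePi_map_eval (fun _ : ℕ => expMeasure 1) 0).symm⟩
    exact h.comp (u := fun x : ℝ => min 1 (max 0 x)) (by fun_prop)
  have hpos : 0 < ∫ g, Y 0 g ∂gapLaw := by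
    rw [integral_pos_iff_support_of_nonneg_ae (Filter.Eventually.of_forall (hY0 0)) hint]
    have : ∀ᵐ g ∂gapLaw, g ∈ Function.support (Y 0) := by
      filter_upwards [ae_gapLaw_pos] with g hg
      exact (lt_min one_pos (lt_max_of_lt_right (hg 0))).ne'
    rw [measure_congr (s := Function.support (Y 0)) (Filter.eventuallyEq_univ.2 this), measure_univ]
    exact one_pos
  filter_upwards [ae_gapLaw_pos, strong_law_ae_real Y hint (fun i j hij => hindep.indepFun hij)
    hident] with g hg hlim
  have h1 : Filter.Tendsto (fun n : ℕ => (∑ i ∈ Finset.range n, Y i g) / n * n)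
      Filter.atTop Filter.atTop :=
    hlim.pos_mul_atTop hpos tendsto_natCast_atTop_atTop
  refine Filter.tendsto_atTop_mono' _ ?_ h1
  filter_upwards [Filter.eventually_gt_atTop 0] with n hn
  have : (n : ℝ) ≠ 0 := by positivity
  rw [div_mul_cancel₀ _ this]
  refine Finset.sum_le_sum fun i _ => (min_le_right _ _).trans ?_
  exact max_le (hg i).le le_rfl

theorem measurable_setLIntegral_Ioc_gapSum (k : ℕ) {h : ℝ × (ℕ → ℝ) → ℝ≥0∞} (hh : Measurable h) :
    Measurable fun g : ℕ → ℝ => ∫⁻ t in Set.Ioc (gapSum g k) (gapSum g (k + 1)), h (t, g) := by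
  have : ∀ g : ℕ → ℝ, ∫⁻ t in Set.Ioc (gapSum g k) (gapSum g (k + 1)), h (t, g) =
      ∫⁻ t, {p : (ℕ → ℝ) × ℝ | gapSum p.1 k < p.2 ∧ p.2 ≤ gapSum p.1 (k + 1)}.indicator
        (fun p => h (p.2, p.1)) (g, t) := by
    intro g
    rw [← lintegral_indicator measurableSet_Ioc]
    rfl
  simp only [this]
  refine Measurable.lintegral_prod_right' (Measurable.indicator (by fun_prop) ?_)
  exact (measurableSet_lt ((measurable_gapSum k).comp measurable_fst) measurable_snd).inter
    (measurableSet_le measurable_snd ((measurable_gapSum (k + 1)).comp measurable_fst))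

/-- Mecke's formula for a single index: deleting arrival `k` amounts to integrating a new point over
the gap with index `k`. Everything but the two gaps around the arrival is held fixed, and these two
are handled by `lintegral_expMeasure_split`. -/
theorem lintegral_mergeGap (k : ℕ) {h : ℝ × (ℕ → ℝ) → ℝ≥0∞} (hh : Measurable h) :
    ∫⁻ g, h (gapSum g (k + 1), mergeGap k g) ∂gapLaw =
      ∫⁻ g, (∫⁻ t in Set.Ioc (gapSum g k) (gapSum g (k + 1)), h (t, g)) ∂gapLaw := by
  have hshift : ∀ (g : ℕ → ℝ) (c : ℝ),
      ∫⁻ t in Set.Ioc (gapSum g k) (gapSum g k + c), h (t, Function.update g k c) =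
        ∫⁻ t in Set.Ioc 0 c, h (gapSum g k + t, Function.update g k c) := by
    intro g c
    rw [← lintegral_indicator measurableSet_Ioc, ← lintegral_indicator measurableSet_Ioc,
      ← lintegral_add_left_eq_self _ (gapSum g k)]
    refine lintegral_congr fun t => ?_
    simp [Set.indicator]
  have hF : Measurable fun g : ℕ → ℝ => h (gapSum g (k + 1), mergeGap k g) := by fun_prop
  have hF₂ : Measurable fun p : (ℕ → ℝ) × ℝ × ℝ =>
      h (gapSum p.1 k + p.2.1, Function.update p.1 k (p.2.1 + p.2.2)) :=
    hh.comp (((measurable_gapSum k).comp measurable_fst |>.add (by fun_prop)).prodMk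
      ((measurable_update_prod k).comp (measurable_fst.prodMk (by fun_prop))))
  have hF₁ : Measurable fun p : ℝ × (ℕ → ℝ) =>
      ∫⁻ b, h (gapSum p.2 k + p.1, Function.update p.2 k (p.1 + b)) ∂(expMeasure 1) :=
    Measurable.lintegral_prod_right'
      (f := fun q : (ℝ × (ℕ → ℝ)) × ℝ =>
        h (gapSum q.1.2 k + q.1.1, Function.update q.1.2 k (q.1.1 + q.2)))
      (hF₂.comp (by fun_prop : Measurable fun q : (ℝ × (ℕ → ℝ)) × ℝ => (q.1.2, q.1.1, q.2)))
  calc ∫⁻ g, h (gapSum g (k + 1), mergeGap k g) ∂gapLaw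
      = ∫⁻ a, ∫⁻ g, h (gapSum g k + a, Function.update g k (a + g k)) ∂gapLaw
          ∂(expMeasure 1) := by
        refine (lintegral_insertAt (expMeasure 1) k hF).trans ?_
        simp only [gapSum_insertAt, mergeGap_insertAt]
        rfl
    _ = ∫⁻ a, ∫⁻ g, ∫⁻ b, h (gapSum g k + a, Function.update g k (a + b)) ∂(expMeasure 1)
          ∂gapLaw ∂(expMeasure 1) := by
        refine lintegral_congr fun a => ?_
        -- Resampling `g k` as an explicit variable `b` exposes the second of the two gaps.
        refine (lintegral_update (expMeasure 1) k (F := fun g =>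
          h (gapSum g k + a, Function.update g k (a + g k))) ?_).trans ?_
        · exact hF₂.comp (by fun_prop : Measurable fun g : ℕ → ℝ => (g, a, g k))
        · simp only [gapSum_update, Function.update_self, Function.update_idem]
          rfl
    _ = ∫⁻ g, ∫⁻ a, ∫⁻ b, h (gapSum g k + a, Function.update g k (a + b)) ∂(expMeasure 1)
          ∂(expMeasure 1) ∂gapLaw := lintegral_lintegral_swap hF₁.aemeasurable
    _ = ∫⁻ g, ∫⁻ c, (∫⁻ t in Set.Ioc 0 c, h (gapSum g k + t, Function.update g k c))
          ∂(expMeasure 1) ∂gapLaw := by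
        refine lintegral_congr fun g => ?_
        refine lintegral_expMeasure_split
          (h := fun p => h (gapSum g k + p.1, Function.update g k p.2)) ?_
        exact hh.comp ((by fun_prop : Measurable fun p : ℝ × ℝ => gapSum g k + p.1).prodMk
          ((measurable_update_prod k).comp (measurable_const.prodMk measurable_snd)))
    _ = ∫⁻ g, (∫⁻ t in Set.Ioc (gapSum g k) (gapSum g (k + 1)), h (t, g)) ∂gapLaw := by
        -- Resampling gap `k` on the right-hand side makes its length the variable `c`.
        refine Eq.symm ((lintegral_update (expMeasure 1) k
          (measurable_setLIntegral_Ioc_gapSum k hh)).trans ?_)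
        simp only [gapSum_succ, gapSum_update, Function.update_self, hshift]
        rfl

theorem iUnion_Ioc_gapSum {g : ℕ → ℝ} (hpos : ∀ i, 0 < g i)
    (htop : Filter.Tendsto (gapSum g) Filter.atTop Filter.atTop) :
    ⋃ k, Set.Ioc (gapSum g k) (gapSum g (k + 1)) = Set.Ioi 0 := by
  have h0 : gapSum g 0 = 0 := by simp [gapSum]
  have hmono : Monotone (gapSum g) := monotone_nat_of_le_succ fun n => by
    rw [gapSum_succ]; linarith [hpos n]
  ext t
  simp only [Set.mem_iUnion, Set.mem_Ioc, Set.mem_Ioi]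
  constructor
  · rintro ⟨k, h1, -⟩
    exact (h0 ▸ hmono (Nat.zero_le k)).trans_lt h1
  · intro ht
    classical
    have hex : ∃ n, t ≤ gapSum g n := (htop.eventually_ge_atTop t).exists
    have hne : Nat.find hex ≠ 0 := by
      intro h
      have := Nat.find_spec hex
      rw [h, h0] at this
      exact absurd this (not_le.2 ht)
    obtain ⟨k, hk⟩ := Nat.exists_eq_succ_of_ne_zero hne
    refine ⟨k, ?_, ?_⟩
    · exact not_le.1 (Nat.find_min hex (by omega))
    · have := Nat.find_spec hex
      rwa [hk] at this

/-- Mecke's formula for a Poisson process of rate one. -/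
theorem tsum_lintegral_mergeGap {h : ℝ × (ℕ → ℝ) → ℝ≥0∞} (hh : Measurable h) :
    ∑' k, ∫⁻ g, h (gapSum g (k + 1), mergeGap k g) ∂gapLaw =
      ∫⁻ g, (∫⁻ t in Set.Ioi 0, h (t, g)) ∂gapLaw := by
  simp only [lintegral_mergeGap _ hh]
  rw [← lintegral_tsum fun k => (measurable_setLIntegral_Ioc_gapSum k hh).aemeasurable]
  refine lintegral_congr_ae ?_
  filter_upwards [ae_gapLaw_pos, ae_gapLaw_tendsto] with g hpos htop
  have hmono : Monotone (gapSum g) := monotone_nat_of_le_succ fun n => by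
    rw [gapSum_succ]; linarith [hpos n]
  rw [← iUnion_Ioc_gapSum hpos htop]
  exact (lintegral_iUnion (fun _ => measurableSet_Ioc) hmono.pairwise_disjoint_on_Ioc_succ _).symm

/-! ### Scaled times and Mecke's formula with marks -/

theorem lintegral_eq_ofReal_mul_lintegral_comp_mul {c : ℝ} (hc : 0 < c) {F : ℝ → ℝ≥0∞}
    (hF : Measurable F) : ∫⁻ t, F t = ENNReal.ofReal c * ∫⁻ s, F (c * s) := by
  conv_lhs => rw [← Real.smul_map_volume_mul_left hc.ne']
  rw [lintegral_smul_measure, lintegral_map hF (by fun_prop), abs_of_pos hc, smul_eq_mul]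

@[fun_prop]
theorem measurable_scaledTime : Measurable fun p : ℝ≥0∞ × ℝ≥0∞ => scaledTime p.1 p.2 := by
  unfold scaledTime
  exact Measurable.ite (measurable_snd (measurableSet_singleton 0)) measurable_const (by fun_prop)

/-- The substitution t = c s turns dt into c ds; this is where the density enters the intensity. If
c = 0 every scaled time is ∞, and `hφt` makes both sides vanish. -/
theorem lintegral_scaledTime {φ : ℝ≥0∞ → ℝ≥0∞} (hφ : Measurable φ) (hφt : φ ∞ = 0) {c : ℝ≥0∞}
    (hc : c ≠ ∞) :
    ∫⁻ t in Set.Ioi (0 : ℝ), φ (scaledTime (ENNReal.ofReal t) c) =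
      c * ∫⁻ s in Set.Ioi (0 : ℝ), φ (ENNReal.ofReal s) := by
  rcases eq_or_ne c 0 with rfl | h0
  · simp [scaledTime, hφt]
  have hpos : 0 < c.toReal := ENNReal.toReal_pos h0 hc
  rw [← lintegral_indicator measurableSet_Ioi, ← lintegral_indicator measurableSet_Ioi,
    lintegral_eq_ofReal_mul_lintegral_comp_mul hpos ?_, ENNReal.ofReal_toReal hc]
  · congr 1
    refine lintegral_congr fun s => ?_
    by_cases hs : 0 < s
    · rw [Set.indicator_of_mem (by exact mul_pos hpos hs), Set.indicator_of_mem (by exact hs),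
        scaledTime, if_neg h0, ENNReal.ofReal_mul hpos.le, ENNReal.ofReal_toReal hc,
        mul_right_comm, ENNReal.mul_inv_cancel h0 hc, one_mul]
    · rw [Set.indicator_of_notMem (by simpa [mul_pos_iff_of_pos_left hpos] using hs),
        Set.indicator_of_notMem (by exact hs)]
  · refine Measurable.indicator (hφ.comp (measurable_scaledTime.comp (by fun_prop :
      Measurable fun t : ℝ => (ENNReal.ofReal t, c)))) measurableSet_Ioi

section Marked

variable {𝒵 : Type*} [MeasurableSpace 𝒵] (Q : Measure 𝒵) [IsProbabilityMeasure Q]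

/-- The law of the marks and of the gaps of a Poisson process with i.i.d. marks. -/
noncomputable def markedLaw : Measure ((ℕ → 𝒵) × (ℕ → ℝ)) :=
  (Measure.infinitePi fun _ : ℕ => Q).prod gapLaw

instance : IsProbabilityMeasure (markedLaw Q) := by unfold markedLaw; infer_instance

/-- Remove the point with index `k` from a marked point process, given by its marks and gaps. -/
def dropAt {E : Type*} (k : ℕ) (p : (ℕ → E) × (ℕ → ℝ)) : (ℕ → E) × (ℕ → ℝ) :=
  (fun j => p.1 (skip k j), mergeGap k p.2)

@[fun_prop]
theorem measurable_dropAt (k : ℕ) :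
    Measurable (dropAt k : (ℕ → 𝒵) × (ℕ → ℝ) → (ℕ → 𝒵) × (ℕ → ℝ)) := by
  unfold dropAt
  fun_prop

/-- Mecke's formula for a Poisson process of rate one with i.i.d. marks. -/
theorem tsum_lintegral_dropAt {H : ℝ × 𝒵 × ((ℕ → 𝒵) × (ℕ → ℝ)) → ℝ≥0∞} (hH : Measurable H) :
    ∑' k, ∫⁻ p, H (gapSum p.2 (k + 1), p.1 k, dropAt k p) ∂(markedLaw Q) =
      ∫⁻ z, ∫⁻ p, (∫⁻ t in Set.Ioi 0, H (t, z, p)) ∂(markedLaw Q) ∂Q := by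
  have hJ : ∀ k, Measurable fun q : 𝒵 × (ℕ → 𝒵) =>
      ∫⁻ g, H (gapSum g (k + 1), q.1, q.2, mergeGap k g) ∂gapLaw := fun k =>
    Measurable.lintegral_prod_right' (f := fun u : (𝒵 × (ℕ → 𝒵)) × (ℕ → ℝ) =>
      H (gapSum u.2 (k + 1), u.1.1, u.1.2, mergeGap k u.2)) (by fun_prop)
  have hk : ∀ k, ∫⁻ p, H (gapSum p.2 (k + 1), p.1 k, dropAt k p) ∂(markedLaw Q) =
      ∫⁻ z, ∫⁻ ζ, ∫⁻ g, H (gapSum g (k + 1), z, ζ, mergeGap k g) ∂gapLaw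
        ∂(Measure.infinitePi fun _ : ℕ => Q) ∂Q := by
    intro k
    rw [markedLaw, lintegral_prod _ (by fun_prop)]
    refine (lintegral_insertAt Q k (F := fun ζ => ∫⁻ g, H (gapSum g (k + 1), ζ k,
      fun j => ζ (skip k j), mergeGap k g) ∂gapLaw) ?_).trans ?_
    · exact (hJ k).comp (by fun_prop : Measurable fun ζ : ℕ → 𝒵 => (ζ k, fun j => ζ (skip k j)))
    · simp only [insertAt_self, insertAt_skip]
  simp only [hk]
  rw [← lintegral_tsum fun k => ((hJ k).lintegral_prod_right').aemeasurable]
  refine lintegral_congr fun z => ?_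
  have hJz : ∀ k, Measurable fun ζ : ℕ → 𝒵 =>
      ∫⁻ g, H (gapSum g (k + 1), z, ζ, mergeGap k g) ∂gapLaw := fun k =>
    (hJ k).comp (by fun_prop : Measurable fun ζ : ℕ → 𝒵 => (z, ζ))
  rw [← lintegral_tsum fun k => (hJz k).aemeasurable, markedLaw, lintegral_prod _ (by
      refine Measurable.aemeasurable ?_
      exact Measurable.lintegral_prod_right' (f := fun u : ((ℕ → 𝒵) × (ℕ → ℝ)) × ℝ =>
        H (u.2, z, u.1)) (by fun_prop))]
  refine lintegral_congr fun ζ => ?_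
  exact tsum_lintegral_mergeGap (h := fun u => H (u.1, z, ζ, u.2)) (by fun_prop)

/-- The scaled times of a marked point process, given by its marks and gaps. -/
noncomputable def tau {E : Type*} (f : E → ℝ≥0∞) (p : (ℕ → E) × (ℕ → ℝ)) (i : ℕ) : ℝ≥0∞ :=
  scaledTime (ENNReal.ofReal (gapSum p.2 (i + 1))) (f (p.1 i))

theorem tau_dropAt {E : Type*} (f : E → ℝ≥0∞) (p : (ℕ → E) × (ℕ → ℝ)) (k i : ℕ) :
    tau f (dropAt k p) i = tau f p (skip k i) := by
  simp [tau, dropAt, gapSum_mergeGap]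

variable {Q} {f : 𝒵 → ℝ≥0∞}

theorem measurable_tau (hf : Measurable f) (i : ℕ) : Measurable fun p => tau f p i := by
  unfold tau
  exact measurable_scaledTime.comp (by fun_prop : Measurable fun p : (ℕ → 𝒵) × (ℕ → ℝ) =>
    (ENNReal.ofReal (gapSum p.2 (i + 1)), f (p.1 i)))

/-- Mecke's formula after scaling the times by the density `f`: the points `(τ i, Z i)` form a
Poisson process whose marks have law `f • Q`. -/
theorem lintegral_tsum_tau (hf : Measurable f) (hfi : ∀ᵐ z ∂Q, f z ≠ ∞) {G : 𝒵 → ℝ≥0∞}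
    (hG : Measurable G) {r : ℝ≥0∞ × ((ℕ → 𝒵) × (ℕ → ℝ)) → ℝ≥0∞} (hr : Measurable r)
    (hrt : ∀ p, r (∞, p) = 0) :
    ∫⁻ p, ∑' k, G (p.1 k) * r (tau f p k, dropAt k p) ∂(markedLaw Q) =
      (∫⁻ z, G z * f z ∂Q) *
        ∫⁻ p, (∫⁻ s in Set.Ioi 0, r (ENNReal.ofReal s, p)) ∂(markedLaw Q) := by
  have hτ := measurable_tau hf
  rw [lintegral_tsum fun k => (by
    exact ((hG.comp (by fun_prop)).mul (hr.comp ((hτ k).prodMk (by fun_prop)))).aemeasurable)]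
  refine (tsum_lintegral_dropAt Q
    (H := fun u => G u.2.1 * r (scaledTime (ENNReal.ofReal u.1) (f u.2.1), u.2.2)) ?_).trans ?_
  · refine (hG.comp (by fun_prop)).mul (hr.comp (Measurable.prodMk ?_ (by fun_prop)))
    exact measurable_scaledTime.comp (by fun_prop :
      Measurable fun u : ℝ × 𝒵 × ((ℕ → 𝒵) × (ℕ → ℝ)) => (ENNReal.ofReal u.1, f u.2.1))
  · have hm : Measurable fun p => ∫⁻ s in Set.Ioi (0 : ℝ), r (ENNReal.ofReal s, p) :=
      Measurable.lintegral_prod_right' (f := fun u : ((ℕ → 𝒵) × (ℕ → ℝ)) × ℝ =>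
        r (ENNReal.ofReal u.2, u.1)) (by fun_prop)
    rw [← lintegral_mul_const _ (by fun_prop)]
    refine lintegral_congr_ae ?_
    filter_upwards [hfi] with z hz
    rw [← lintegral_const_mul _ hm]
    refine lintegral_congr fun p => ?_
    have hmt : Measurable fun t : ℝ => r (scaledTime (ENNReal.ofReal t) (f z), p) :=
      hr.comp (Measurable.prodMk (measurable_scaledTime.comp (by fun_prop :
        Measurable fun t : ℝ => (ENNReal.ofReal t, f z))) measurable_const)
    rw [lintegral_const_mul _ hmt,
      lintegral_scaledTime (φ := fun u => r (u, p)) (by fun_prop) (hrt p) hz, mul_assoc]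

end Marked

/-! ### Selection with a finite exponent -/

theorem tsum_eq_add_tsum_skip (x : ℕ → ℝ≥0∞) (k : ℕ) :
    ∑' i, x i = x k + ∑' j, x (skip k j) := by
  classical
  rw [ENNReal.tsum_eq_add_tsum_ite k]
  congr 1
  rw [← (skip_injective k).tsum_eq]
  · exact tsum_congr fun j => if_neg (skip_ne k j)
  · intro i hi
    by_cases h : i = k
    · simp [h] at hi
    · exact exists_skip_eq h

/-- Only finitely many terms can be at least one, and truncation changes no others. -/
theorem tsum_ne_top_of_tsum_min_one_ne_top {x : ℕ → ℝ≥0∞} (h : ∑' i, min 1 (x i) ≠ ∞)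
    (hx : ∀ i, x i ≠ ∞) : ∑' i, x i ≠ ∞ := by
  classical
  have hfin : {i | 1 ≤ min 1 (x i)}.Finite := ENNReal.finite_const_le_of_tsum_ne_top h one_ne_zero
  have hle : ∀ i, x i ≤ min 1 (x i) + if i ∈ hfin.toFinset then x i else 0 := by
    intro i
    by_cases hi : 1 ≤ x i
    · simp [hi]
    · simp [hi, (not_le.1 hi).le]
  refine ne_top_of_le_ne_top ?_ (ENNReal.tsum_le_tsum hle)
  rw [ENNReal.tsum_add]
  refine ENNReal.add_ne_top.2 ⟨h, ?_⟩
  rw [tsum_eq_sum (s := hfin.toFinset) fun i hi => if_neg hi]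
  refine ENNReal.sum_ne_top.2 fun i hi => ?_
  rw [if_pos hi]
  exact hx i

theorem lintegral_min_one_rpow_neg_lt_top {a : ℝ} (ha : 1 < a) :
    ∫⁻ s in Set.Ioi (0 : ℝ), min 1 (ENNReal.ofReal s ^ (-a)) < ∞ := by
  rw [← Set.Ioc_union_Ioi_eq_Ioi (zero_le_one' ℝ)]
  refine (lintegral_union_le _ _ _).trans_lt (ENNReal.add_lt_top.2 ⟨?_, ?_⟩)
  · refine (lintegral_mono fun s => min_le_left _ _).trans_lt ?_
    simp
  · refine (setLIntegral_mono' (g := fun s : ℝ => ENNReal.ofReal (s ^ (-a))) measurableSet_Ioi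
      fun s hs => ?_).trans_lt ?_
    · refine (min_le_right _ _).trans ?_
      rw [ENNReal.ofReal_rpow_of_pos (zero_lt_one.trans hs)]
    · have hi : IntegrableOn (fun s : ℝ => s ^ (-a)) (Set.Ioi 1) :=
        integrableOn_Ioi_rpow_of_lt (by linarith) one_pos
      exact hi.lintegral_lt_top

/-- This makes the selection probability of a point a function of its scaled time and of the
remaining points, as Mecke's formula requires. -/
theorem normalizer_eq_add {E : Type*} (a : ℝ) (f : E → ℝ≥0∞) (p : (ℕ → E) × (ℕ → ℝ)) (k : ℕ) :
    normalizer a (tau f p) = tau f p k ^ (-a) + normalizer a (tau f (dropAt k p)) := by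
  simp only [normalizer, tau_dropAt]
  exact tsum_eq_add_tsum_skip _ k

theorem tsum_selectionProb (a : ℝ) (τ : ℕ → ℝ≥0∞) :
    ∑' k, selectionProb a τ k = normalizer a τ / normalizer a τ := by
  simp only [selectionProb, div_eq_mul_inv, ENNReal.tsum_mul_right]
  rfl

theorem ae_ne_top_of_lintegral_eq_one {𝒵 : Type*} [MeasurableSpace 𝒵] {Q : Measure 𝒵}
    {f : 𝒵 → ℝ≥0∞} (hf : Measurable f) (hf1 : ∫⁻ z, f z ∂Q = 1) :
    ∀ᵐ z ∂Q, f z ≠ ∞ := by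
  filter_upwards [ae_lt_top hf (hf1.trans_ne ENNReal.one_ne_top)] with z hz using hz.ne

section Marked

variable {𝒵 : Type*} [MeasurableSpace 𝒵] {Q : Measure 𝒵} [IsProbabilityMeasure Q]
  {f : 𝒵 → ℝ≥0∞}

theorem ae_markedLaw_tau_ne_zero (hf : Measurable f) (hf1 : ∫⁻ z, f z ∂Q = 1) :
    ∀ᵐ p ∂(markedLaw Q), ∀ i, tau f p i ≠ 0 := by
  have h1 : ∀ᵐ p ∂(markedLaw Q), ∀ i, 0 < p.2 i :=
    Measure.quasiMeasurePreserving_snd.ae ae_gapLaw_pos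
  have h2 : ∀ᵐ p ∂(markedLaw Q), ∀ i, f (p.1 i) ≠ ∞ := by
    have : ∀ᵐ ζ ∂(Measure.infinitePi fun _ : ℕ => Q), ∀ i, f (ζ i) ≠ ∞ := ae_all_iff.2 fun i =>
      (measurePreserving_eval_infinitePi (fun _ : ℕ => Q) i).quasiMeasurePreserving.ae
        (ae_ne_top_of_lintegral_eq_one hf hf1)
    exact Measure.quasiMeasurePreserving_fst.ae this
  filter_upwards [h1, h2] with p hp1 hp2 i
  unfold tau scaledTime
  split_ifs
  · simp
  · refine mul_ne_zero ?_ (ENNReal.inv_ne_zero.2 (hp2 i))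
    rw [Ne, ENNReal.ofReal_eq_zero, not_le]
    exact Finset.sum_pos (fun j _ => hp1 j) (by simp)

/-- Campbell's formula for the scaled times. -/
theorem lintegral_tsum_comp_tau (hf : Measurable f) (hf1 : ∫⁻ z, f z ∂Q = 1) {φ : ℝ≥0∞ → ℝ≥0∞}
    (hφ : Measurable φ) (hφt : φ ∞ = 0) :
    ∫⁻ p, ∑' k, φ (tau f p k) ∂(markedLaw Q) = ∫⁻ s in Set.Ioi (0 : ℝ), φ (ENNReal.ofReal s) := by
  have h := lintegral_tsum_tau hf (ae_ne_top_of_lintegral_eq_one hf hf1) (G := fun _ => 1)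
    measurable_const (r := fun u => φ u.1) (by fun_prop) (fun _ => hφt)
  simpa [hf1] using h

theorem measurable_normalizer_tau (hf : Measurable f) (a : ℝ) :
    Measurable fun p => normalizer a (tau f p) := by
  unfold normalizer
  exact Measurable.tsum fun i => (measurable_tau hf i).pow_const _

/-- Campbell's formula for min(1, u^(-a)): the tail is integrable because a > 1, and the truncation
removes the singularity at 0. Truncation is harmless since no scaled time is 0. -/
theorem ae_markedLaw_normalizer_ne_top (hf : Measurable f) (hf1 : ∫⁻ z, f z ∂Q = 1) {a : ℝ}
    (ha : 1 < a) : ∀ᵐ p ∂(markedLaw Q), normalizer a (tau f p) ≠ ∞ := by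
  have hφ : Measurable fun u : ℝ≥0∞ => min 1 (u ^ (-a)) := by fun_prop
  have h := lintegral_tsum_comp_tau (Q := Q) hf hf1 hφ (by
    simp [ENNReal.top_rpow_of_neg (neg_lt_zero.2 (zero_lt_one.trans ha))])
  have hm : Measurable fun p => ∑' k, min 1 (tau f p k ^ (-a)) :=
    Measurable.tsum fun i => hφ.comp (measurable_tau hf i)
  filter_upwards [ae_lt_top hm (h.trans_lt (lintegral_min_one_rpow_neg_lt_top ha)).ne,
    ae_markedLaw_tau_ne_zero hf hf1] with p hp hp0
  refine tsum_ne_top_of_tsum_min_one_ne_top hp.ne fun i => ?_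
  rw [Ne, ENNReal.rpow_eq_top_iff]
  have := hp0 i
  rintro (⟨h, -⟩ | ⟨-, h⟩)
  · exact this h
  · linarith

/-- The probability that a point at the scaled time `u` is selected from the other points `p`. -/
noncomputable def addedProb (a : ℝ) (f : 𝒵 → ℝ≥0∞) (u : ℝ≥0∞ × ((ℕ → 𝒵) × (ℕ → ℝ))) : ℝ≥0∞ :=
  u.1 ^ (-a) / (u.1 ^ (-a) + normalizer a (tau f u.2))

theorem measurable_addedProb (hf : Measurable f) (a : ℝ) : Measurable (addedProb a f) := by
  have h : Measurable fun u : ℝ≥0∞ × ((ℕ → 𝒵) × (ℕ → ℝ)) => normalizer a (tau f u.2) :=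
    (measurable_normalizer_tau hf a).comp measurable_snd
  exact (measurable_fst.pow_const _).div ((measurable_fst.pow_const _).add h)

/-- The second factor does not involve `G`: the mark of the selected point decouples from the
selection. -/
theorem lintegral_tsum_selectionProb_eq_mul (hf : Measurable f) (hf1 : ∫⁻ z, f z ∂Q = 1) {a : ℝ}
    (ha : 1 < a) {G : 𝒵 → ℝ≥0∞} (hG : Measurable G) :
    ∫⁻ p, ∑' k, G (p.1 k) * selectionProb a (tau f p) k ∂(markedLaw Q) =
      (∫⁻ z, G z * f z ∂Q) *
        ∫⁻ p, (∫⁻ s in Set.Ioi 0, addedProb a f (ENNReal.ofReal s, p)) ∂(markedLaw Q) := by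
  rw [← lintegral_tsum_tau hf (ae_ne_top_of_lintegral_eq_one hf hf1) hG (measurable_addedProb hf a)
    fun p => by
      simp [addedProb, ENNReal.top_rpow_of_neg (neg_lt_zero.2 (zero_lt_one.trans ha))]]
  simp only [selectionProb, addedProb, ← normalizer_eq_add]

/-- With `G = 1` the constant of the previous lemma is at most 1, as x / x ≤ 1 in `ℝ≥0∞`. If the
normalizer vanished, an added point would be selected with probability 1 at every time s > 0, and
the integral over s would be infinite. -/
theorem ae_markedLaw_normalizer_ne_zero (hf : Measurable f) (hf1 : ∫⁻ z, f z ∂Q = 1) {a : ℝ}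
    (ha : 1 < a) : ∀ᵐ p ∂(markedLaw Q), normalizer a (tau f p) ≠ 0 := by
  have h := lintegral_tsum_selectionProb_eq_mul hf hf1 ha (G := fun _ => 1) measurable_const
  simp only [one_mul, hf1, tsum_selectionProb] at h
  have hle : ∫⁻ p, (∫⁻ s in Set.Ioi 0, addedProb a f (ENNReal.ofReal s, p)) ∂(markedLaw Q) ≤ 1 := by
    rw [← h]
    refine (lintegral_mono fun p => ENNReal.div_self_le_one).trans ?_
    simp
  have hm : Measurable fun p => ∫⁻ s in Set.Ioi (0 : ℝ), addedProb a f (ENNReal.ofReal s, p) :=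
    Measurable.lintegral_prod_right' (f := fun u : ((ℕ → 𝒵) × (ℕ → ℝ)) × ℝ =>
      addedProb a f (ENNReal.ofReal u.2, u.1)) ((measurable_addedProb hf a).comp (by fun_prop))
  filter_upwards [ae_lt_top hm (hle.trans_lt ENNReal.one_lt_top).ne] with p hp h0
  refine hp.ne ?_
  rw [setLIntegral_congr_fun (g := fun _ => 1) measurableSet_Ioi fun s hs => ?_]
  · simp
  · simp only [addedProb, h0, add_zero]
    rw [ENNReal.ofReal_rpow_of_pos hs]
    exact ENNReal.div_self (ENNReal.ofReal_pos.2 (Real.rpow_pos_of_pos hs _)).ne'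
      ENNReal.ofReal_ne_top

/-- The case `G = 1` evaluates the constant: it is 1, because the normalizer is almost surely
neither 0 nor ∞. -/
theorem lintegral_tsum_selectionProb (hf : Measurable f) (hf1 : ∫⁻ z, f z ∂Q = 1) {a : ℝ}
    (ha : 1 < a) {G : 𝒵 → ℝ≥0∞} (hG : Measurable G) :
    ∫⁻ p, ∑' k, G (p.1 k) * selectionProb a (tau f p) k ∂(markedLaw Q) = ∫⁻ z, G z * f z ∂Q := by
  have h := lintegral_tsum_selectionProb_eq_mul hf hf1 ha (G := fun _ => 1) measurable_const
  simp only [one_mul, hf1, tsum_selectionProb] at h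
  rw [lintegral_tsum_selectionProb_eq_mul hf hf1 ha hG, ← h]
  have : ∫⁻ p, normalizer a (tau f p) / normalizer a (tau f p) ∂(markedLaw Q) =
      ∫⁻ _, 1 ∂(markedLaw Q) := by
    refine lintegral_congr_ae ?_
    filter_upwards [ae_markedLaw_normalizer_ne_zero hf hf1 ha,
      ae_markedLaw_normalizer_ne_top hf hf1 ha] with p h0 h1 using ENNReal.div_self h0 h1
  rw [this]
  simp

end Marked

/-! ### Selection of the minimizer -/

/-- If the normalizer is positive and finite, the scaled times have a minimizer. -/
theorem exists_isArgmin {a : ℝ} (ha : 0 < a) {τ : ℕ → ℝ≥0∞} (h0 : normalizer a τ ≠ 0)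
    (h1 : normalizer a τ ≠ ∞) : ∃ k, IsArgmin τ k ∧ τ k ≠ ∞ := by
  obtain ⟨j, hj⟩ : ∃ j, τ j ^ (-a) ≠ 0 := by
    by_contra! h
    exact h0 (ENNReal.tsum_eq_zero.2 h)
  -- A convergent sum has finitely many terms above a positive level, so the largest term is
  -- attained; it belongs to the smallest time.
  have hfin : {i | τ j ^ (-a) ≤ τ i ^ (-a)}.Finite := ENNReal.finite_const_le_of_tsum_ne_top h1 hj
  obtain ⟨k, hk, hmax⟩ := Set.exists_max_image _ (fun i => τ i ^ (-a)) hfin ⟨j, by simp⟩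
  have hle : ∀ i, τ i ^ (-a) ≤ τ k ^ (-a) := fun i => by
    rcases le_total (τ j ^ (-a)) (τ i ^ (-a)) with h | h
    · exact hmax i h
    · exact h.trans hk
  refine ⟨k, fun i => ?_, fun ht => hj ?_⟩
  · have := hle i
    rw [ENNReal.rpow_neg, ENNReal.rpow_neg, ENNReal.inv_le_inv] at this
    exact (ENNReal.rpow_le_rpow_iff ha).1 this
  · have := hle j
    rw [ht, ENNReal.top_rpow_of_neg (neg_lt_zero.2 ha)] at this
    exact le_antisymm this bot_le

section Marked

variable {𝒵 : Type*} [MeasurableSpace 𝒵] {Q : Measure 𝒵} [IsProbabilityMeasure Q]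
  {f : 𝒵 → ℝ≥0∞}

/-- Almost surely, no two finite scaled times coincide. -/
theorem ae_markedLaw_tau_ne (hf : Measurable f) (hf1 : ∫⁻ z, f z ∂Q = 1) :
    ∀ᵐ p ∂(markedLaw Q), ∀ k i, i ≠ k → tau f p k ≠ ∞ → tau f p i ≠ tau f p k := by
  -- Infinite times may coincide, at marks of density 0; excluding them also makes `r` vanish at ∞.
  set S : ℕ → Set (ℝ≥0∞ × ((ℕ → 𝒵) × (ℕ → ℝ))) := fun i => {u | u.1 ≠ ∞ ∧ tau f u.2 i = u.1} with hS
  have hSm : ∀ i, MeasurableSet (S i) := fun i =>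
    (measurable_fst (measurableSet_singleton ∞).compl).inter
      (measurableSet_eq_fun ((measurable_tau hf i).comp measurable_snd) measurable_fst)
  set r : ℝ≥0∞ × ((ℕ → 𝒵) × (ℕ → ℝ)) → ℝ≥0∞ := fun u => ∑' i, (S i).indicator 1 u with hr
  have hrm : Measurable r := Measurable.tsum fun i => measurable_one.indicator (hSm i)
  have h := lintegral_tsum_tau hf (ae_ne_top_of_lintegral_eq_one hf hf1) (G := fun _ => 1)
    measurable_const hrm (fun p => by simp [hr, hS])
  have hz : ∀ p, ∫⁻ s in Set.Ioi (0 : ℝ), r (ENNReal.ofReal s, p) = 0 := by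
    intro p
    have hrs : Measurable fun s : ℝ => r (ENNReal.ofReal s, p) := hrm.comp (by fun_prop)
    rw [lintegral_eq_zero_iff hrs]
    -- By Mecke's formula the added time ranges over Lebesgue measure, which does not charge the
    -- countably many existing times.
    have hne : ∀ᵐ s : ℝ, ∀ i, s ≠ (tau f p i).toReal := ae_all_iff.2 fun i => Measure.ae_ne _ _
    filter_upwards [ae_restrict_of_ae hne, ae_restrict_mem measurableSet_Ioi] with s hs hs0
    simp only [hr, Pi.zero_apply, ENNReal.tsum_eq_zero]
    intro i
    refine Set.indicator_of_notMem ?_ _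
    rintro ⟨-, heq⟩
    refine hs i ?_
    simp only at heq
    rw [heq, ENNReal.toReal_ofReal (le_of_lt hs0)]
  simp only [hz, lintegral_zero, mul_zero, one_mul] at h
  have hm : Measurable fun p => ∑' k, r (tau f p k, dropAt k p) := Measurable.tsum fun k =>
    hrm.comp ((measurable_tau hf k).prodMk (measurable_dropAt k))
  rw [lintegral_eq_zero_iff hm] at h
  filter_upwards [h] with p hp k i hik hk heq
  obtain ⟨j, rfl⟩ := exists_skip_eq hik
  have h1 := ENNReal.tsum_eq_zero.1 hp k
  have h2 := ENNReal.tsum_eq_zero.1 h1 j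
  have hmem : (tau f p k, dropAt k p) ∈ S j := ⟨hk, by rw [tau_dropAt, heq]⟩
  simp [Set.indicator_of_mem hmem] at h2

theorem ae_markedLaw_existsUnique_isArgmin (hf : Measurable f) (hf1 : ∫⁻ z, f z ∂Q = 1) :
    ∀ᵐ p ∂(markedLaw Q), ∃ k, IsArgmin (tau f p) k ∧ ∀ i, i ≠ k → tau f p k < tau f p i := by
  filter_upwards [ae_markedLaw_normalizer_ne_zero hf hf1 one_lt_two,
    ae_markedLaw_normalizer_ne_top hf hf1 one_lt_two, ae_markedLaw_tau_ne hf hf1] with p h0 h1 h2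
  obtain ⟨k, hk, hkt⟩ := exists_isArgmin two_pos h0 h1
  exact ⟨k, hk, fun i hi => lt_of_le_of_ne (hk i) (h2 k i hi hkt).symm⟩

/-- The argument for finite exponents, with the indicator of being the minimizer in place of the
selection probability. -/
theorem lintegral_tsum_isArgmin (hf : Measurable f) (hf1 : ∫⁻ z, f z ∂Q = 1) {G : 𝒵 → ℝ≥0∞}
    (hG : Measurable G) :
    ∫⁻ p, ∑' k, G (p.1 k) * {k | IsArgmin (tau f p) k}.indicator 1 k ∂(markedLaw Q) =
      ∫⁻ z, G z * f z ∂Q := by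
  -- The strict inequality excludes u = ∞, as Mecke's formula needs; it agrees with `IsArgmin`
  -- because the minimizer is almost surely unique and strict.
  set S : Set (ℝ≥0∞ × ((ℕ → 𝒵) × (ℕ → ℝ))) := {u | ∀ i, u.1 < tau f u.2 i} with hS
  have hSm : MeasurableSet S := by
    rw [hS, Set.ofPred_forall]
    exact MeasurableSet.iInter fun i =>
      measurableSet_lt measurable_fst ((measurable_tau hf i).comp measurable_snd)
  have hmul : ∀ {G : 𝒵 → ℝ≥0∞}, Measurable G →
      ∫⁻ p, ∑' k, G (p.1 k) * {k | IsArgmin (tau f p) k}.indicator 1 k ∂(markedLaw Q) =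
      (∫⁻ z, G z * f z ∂Q) *
        ∫⁻ p, (∫⁻ s in Set.Ioi 0, S.indicator 1 (ENNReal.ofReal s, p)) ∂(markedLaw Q) := by
    intro G hG
    rw [← lintegral_tsum_tau hf (ae_ne_top_of_lintegral_eq_one hf hf1) hG
      (measurable_one.indicator hSm) (fun p => by simp [hS])]
    refine lintegral_congr_ae ?_
    filter_upwards [ae_markedLaw_existsUnique_isArgmin hf hf1] with p ⟨k, hk, hlt⟩
    refine tsum_congr fun j => ?_
    congr 1
    have : IsArgmin (tau f p) j ↔ (tau f p j, dropAt j p) ∈ S := by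
      simp only [hS, Set.mem_ofPred_eq, tau_dropAt]
      constructor
      · intro hj i
        have hjk : j = k := by
          by_contra hne
          exact absurd (hj k) (not_le.2 (hlt j hne))
        subst hjk
        exact hlt _ (skip_ne j i)
      · intro h i
        by_cases hij : i = j
        · rw [hij]
        · obtain ⟨l, rfl⟩ := exists_skip_eq hij
          exact (h l).le
    by_cases hj : IsArgmin (tau f p) j
    · rw [Set.indicator_of_mem (by exact hj), Set.indicator_of_mem (this.1 hj)]
      rfl
    · rw [Set.indicator_of_notMem (by exact hj), Set.indicator_of_notMem (fun h => hj (this.2 h))]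
  have h := hmul (G := fun _ => 1) measurable_const
  simp only [one_mul, hf1] at h
  rw [hmul hG, ← h]
  have : ∫⁻ p, ∑' k, {k | IsArgmin (tau f p) k}.indicator (1 : ℕ → ℝ≥0∞) k ∂(markedLaw Q) =
      ∫⁻ _, 1 ∂(markedLaw Q) := by
    refine lintegral_congr_ae ?_
    filter_upwards [ae_markedLaw_existsUnique_isArgmin hf hf1] with p ⟨k, hk, hlt⟩
    rw [tsum_eq_single k, Set.indicator_of_mem (by exact hk)]
    · rfl
    · intro j hj
      exact Set.indicator_of_notMem 
        (fun h : IsArgmin (tau f p) j => absurd (h k) (not_le.2 (hlt j hj))) _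
  rw [this]
  simp

end Marked

/-! ### Transfer to a random input -/

section Source

variable {Ω 𝒳 𝒵 : Type*} [MeasurableSpace Ω] [MeasurableSpace 𝒳] [MeasurableSpace 𝒵]
  {μ : Measure Ω} {Q : Measure 𝒵}
  {X : Ω → 𝒳} {Z : ℕ → Ω → 𝒵} {T : ℕ → Ω → ℝ} {f : 𝒳 → 𝒵 → ℝ≥0∞}

/-- The marks and gaps of the marked Poisson process of the encoder. -/
def markedPoints {Ω 𝒵 : Type*} (Z : ℕ → Ω → 𝒵) (T : ℕ → Ω → ℝ) (ω : Ω) : (ℕ → 𝒵) × (ℕ → ℝ) :=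
  (fun i => Z i ω, fun i => gap T i ω)

theorem gapSum_gap {Ω : Type*} (T : ℕ → Ω → ℝ) (ω : Ω) (i : ℕ) :
    gapSum (fun i => gap T i ω) (i + 1) = T i ω := by
  induction i with
  | zero => simp [gapSum, gap]
  | succ n ih => rw [gapSum_succ, ih]; simp [gap]

theorem tau_markedPoints {Ω 𝒳 𝒵 : Type*} (f : 𝒳 → 𝒵 → ℝ≥0∞) (X : Ω → 𝒳) (Z : ℕ → Ω → 𝒵)
    (T : ℕ → Ω → ℝ) (ω : Ω) : tau (f (X ω)) (markedPoints Z T ω) = scaledTimes f X Z T ω := by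
  ext i
  simp [tau, markedPoints, scaledTimes, gapSum_gap]

theorem measurable_gap {T : ℕ → Ω → ℝ} (hT : ∀ i, Measurable (T i)) (i : ℕ) :
    Measurable (gap T i) := by
  cases i with
  | zero => exact hT 0
  | succ n => exact (hT (n + 1)).sub (hT n)

theorem IsSource.measurable_markedPoints (h : IsSource Q X Z T μ) :
    Measurable (markedPoints Z T) :=
  (measurable_pi_iff.2 h.sample.measurable).prodMk
    (measurable_pi_iff.2 (measurable_gap h.poisson.measurable))

theorem IsSource.measurable_encoderData (h : IsSource Q X Z T μ) : Measurable (encoderData X Z T) :=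
  h.measurable_data.prodMk ((measurable_pi_iff.2 h.sample.measurable).prodMk
    (measurable_pi_iff.2 h.poisson.measurable))

variable [IsProbabilityMeasure μ] [IsProbabilityMeasure Q]

/-- The data and the marked Poisson process of the encoder are independent, and the latter has the
law `markedLaw Q`. -/
theorem IsSource.map_eq (h : IsSource Q X Z T μ) :
    μ.map (fun ω => (X ω, markedPoints Z T ω)) = (μ.map X).prod (markedLaw Q) := by
  have hX := h.measurable_data
  have hZ : Measurable fun ω i => Z i ω := measurable_pi_iff.2 h.sample.measurable
  have hg : Measurable fun ω i => gap T i ω :=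
    measurable_pi_iff.2 (measurable_gap h.poisson.measurable)
  have hZlaw : μ.map (fun ω i => Z i ω) = Measure.infinitePi fun _ => Q :=
    (h.sample.indep.hasLaw_infinitePi h.sample.law hZ.aemeasurable).map_eq
  have hglaw : μ.map (fun ω i => gap T i ω) = gapLaw :=
    (h.poisson.indep.hasLaw_infinitePi h.poisson.law hg.aemeasurable).map_eq
  have hm : Measurable fun (t : ℕ → ℝ) i => gap (fun n (t : ℕ → ℝ) => t n) i t :=
    measurable_pi_iff.2 (measurable_gap fun i => measurable_pi_apply i)
  have hgT : (fun (t : ℕ → ℝ) i => gap (fun n (t : ℕ → ℝ) => t n) i t) ∘ (fun ω i => T i ω) =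
      fun ω i => gap T i ω := by
    ext ω i
    cases i <;> rfl
  -- The gaps are a measurable function of the arrival times, hence inherit their independence.
  have hind : IndepFun (fun ω => (X ω, fun i => Z i ω)) (fun ω i => gap T i ω) μ := by
    have := h.indep_poisson.comp measurable_id hm
    rwa [hgT] at this
  have h1 := h.indep_data_sample.map_prod_eq_prod_map_map hX.aemeasurable hZ.aemeasurable
  have h2 := hind.map_prod_eq_prod_map_map (hX.prodMk hZ).aemeasurable hg.aemeasurable
  rw [h1, hZlaw, hglaw] at h2
  rw [markedLaw, ← Measure.prodAssoc_prod, ← h2,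
    Measure.map_map (by fun_prop) ((hX.prodMk hZ).prodMk hg)]
  rfl

theorem IsSource.lintegral_eq (h : IsSource Q X Z T μ)
    {Φ : 𝒳 × ((ℕ → 𝒵) × (ℕ → ℝ)) → ℝ≥0∞} (hΦ : Measurable Φ) :
    ∫⁻ ω, Φ (X ω, markedPoints Z T ω) ∂μ = ∫⁻ ω, ∫⁻ p, Φ (X ω, p) ∂(markedLaw Q) ∂μ := by
  rw [← lintegral_map hΦ (h.measurable_data.prodMk h.measurable_markedPoints), h.map_eq,
    lintegral_prod _ hΦ.aemeasurable, lintegral_map hΦ.lintegral_prod_right' h.measurable_data]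

/-- Fubini for the indicator of the complement: what holds almost surely for each frozen input holds
for the random one. -/
theorem IsSource.ae_of_ae (h : IsSource Q X Z T μ) {A : Set (𝒳 × ((ℕ → 𝒵) × (ℕ → ℝ)))}
    (hA : MeasurableSet A) (hae : ∀ᵐ ω ∂μ, ∀ᵐ p ∂(markedLaw Q), (X ω, p) ∈ A) :
    ∀ᵐ ω ∂μ, (X ω, markedPoints Z T ω) ∈ A := by
  have hm : Measurable fun u => Aᶜ.indicator (1 : 𝒳 × ((ℕ → 𝒵) × (ℕ → ℝ)) → ℝ≥0∞) u :=
    measurable_one.indicator hA.compl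
  have hint := h.lintegral_eq hm
  have hz : ∫⁻ ω, ∫⁻ p, Aᶜ.indicator (1 : 𝒳 × ((ℕ → 𝒵) × (ℕ → ℝ)) → ℝ≥0∞) (X ω, p)
      ∂(markedLaw Q) ∂μ = 0 := by
    rw [← lintegral_zero (μ := μ)]
    refine lintegral_congr_ae ?_
    filter_upwards [hae] with ω hω
    rw [← lintegral_zero (μ := markedLaw Q)]
    refine lintegral_congr_ae ?_
    filter_upwards [hω] with p hp
    simp [hp]
  have hmω : Measurable fun ω => Aᶜ.indicator (1 : 𝒳 × ((ℕ → 𝒵) × (ℕ → ℝ)) → ℝ≥0∞)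
      (X ω, markedPoints Z T ω) :=
    hm.comp (h.measurable_data.prodMk h.measurable_markedPoints)
  rw [hz, lintegral_eq_zero_iff hmω] at hint
  filter_upwards [hint] with ω hω
  by_contra hn
  simp [hn] at hω

theorem measurable_tau_prod (hf : Measurable (Function.uncurry f)) :
    Measurable fun u : 𝒳 × ((ℕ → 𝒵) × (ℕ → ℝ)) => tau (f u.1) u.2 := by
  refine measurable_pi_iff.2 fun i => ?_
  unfold tau
  have h : Measurable fun u : 𝒳 × ((ℕ → 𝒵) × (ℕ → ℝ)) => f u.1 (u.2.1 i) :=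
    hf.comp (by fun_prop : Measurable fun u : 𝒳 × ((ℕ → 𝒵) × (ℕ → ℝ)) => (u.1, u.2.1 i))
  exact measurable_scaledTime.comp (Measurable.prodMk (Measurable.ennreal_ofReal (by fun_prop)) h)

theorem measurable_normalizer (a : ℝ) : Measurable (normalizer a) := by
  unfold normalizer
  exact Measurable.tsum fun i => (measurable_pi_apply i).pow_const _

theorem measurable_selectionProb (a : ℝ) (k : ℕ) : Measurable fun τ => selectionProb a τ k := by
  unfold selectionProb
  exact ((measurable_pi_apply k).pow_const _).div (measurable_normalizer a)

theorem selectionProb_le_one (a : ℝ) (τ : ℕ → ℝ≥0∞) (k : ℕ) : selectionProb a τ k ≤ 1 := by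
  refine ENNReal.div_le_of_le_mul ?_
  rw [one_mul]
  exact ENNReal.le_tsum k

theorem measurableSet_isArgmin (k : ℕ) : MeasurableSet {τ : ℕ → ℝ≥0∞ | IsArgmin τ k} := by
  unfold IsArgmin
  rw [Set.ofPred_forall]
  exact MeasurableSet.iInter fun i =>
    measurableSet_le (measurable_pi_apply k) (measurable_pi_apply i)

theorem measurableSet_existsUnique_isArgmin :
    MeasurableSet {τ : ℕ → ℝ≥0∞ | ∃! k, IsArgmin τ k} := by
  have : {τ : ℕ → ℝ≥0∞ | ∃! k, IsArgmin τ k} =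
      ⋃ k, ({τ | IsArgmin τ k} ∩ ⋂ j, ⋂ (_ : j ≠ k), {τ | IsArgmin τ j}ᶜ) := by
    ext τ
    simp only [Set.mem_ofPred_eq, Set.mem_iUnion, Set.mem_inter_iff, Set.mem_iInter,
      Set.mem_compl_iff]
    exact exists_congr fun k => and_congr Iff.rfl (forall_congr' fun j => not_imp_not.symm)
  rw [this]
  exact MeasurableSet.iUnion fun k => (measurableSet_isArgmin k).inter
    (MeasurableSet.iInter fun j => MeasurableSet.iInter fun _ => (measurableSet_isArgmin j).compl)

theorem measurable_decoderOutput (hZ : ∀ i, Measurable (Z i)) {K : Ω → ℕ} (hK : Measurable K) :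
    Measurable (decoderOutput Z K) :=
  (measurable_from_prod_countable_right (f := fun p : ℕ × Ω => Z p.1 p.2) hZ).comp
    (hK.prodMk measurable_id)

/-- If the index `K` is drawn with weights `w` that depend on the scaled times only, and if these
weights simulate the mechanism for almost every input, then so does the decoder output. -/
theorem IsSource.hasCondDistrib (h : IsSource Q X Z T μ) (hf : Measurable (Function.uncurry f))
    {κ : Kernel 𝒳 𝒵} [IsMarkovKernel κ] {w : (ℕ → ℝ≥0∞) → ℕ → ℝ≥0∞}
    (hw : ∀ k, Measurable fun τ => w τ k)
    (hsim : ∀ B, MeasurableSet B → ∀ᵐ ω ∂μ,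
      ∫⁻ p, ∑' k, B.indicator 1 (p.1 k) * w (tau (f (X ω)) p) k ∂(markedLaw Q) = κ (X ω) B)
    {K : Ω → ℕ} (hK : Measurable K)
    (hrule : ∀ k E, MeasurableSet[MeasurableSpace.comap (encoderData X Z T) inferInstance] E →
      μ (E ∩ K ⁻¹' {k}) = ∫⁻ ω in E, w (scaledTimes f X Z T ω) k ∂μ) :
    HasCondDistrib (decoderOutput Z K) X κ μ := by
  have hX := h.measurable_data
  have hY := measurable_decoderOutput h.sample.measurable hK
  refine ⟨(hX.prodMk hY).aemeasurable, ?_⟩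
  have : IsProbabilityMeasure (μ.map fun ω => (X ω, decoderOutput Z K ω)) :=
    Measure.isProbabilityMeasure_map (hX.prodMk hY).aemeasurable
  refine Measure.ext_prod fun {A B} hA hB => ?_
  have hτ := measurable_tau_prod hf
  set Φ : 𝒳 × ((ℕ → 𝒵) × (ℕ → ℝ)) → ℝ≥0∞ := fun u =>
    A.indicator 1 u.1 * ∑' k, B.indicator 1 (u.2.1 k) * w (tau (f u.1) u.2) k with hΦ
  have hA1 : Measurable (A.indicator (1 : 𝒳 → ℝ≥0∞)) := measurable_one.indicator hA
  have hB1 : Measurable (B.indicator (1 : 𝒵 → ℝ≥0∞)) := measurable_one.indicator hB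
  have hterm : ∀ k, Measurable fun u : 𝒳 × ((ℕ → 𝒵) × (ℕ → ℝ)) =>
      B.indicator (1 : 𝒵 → ℝ≥0∞) (u.2.1 k) * w (tau (f u.1) u.2) k := fun k =>
    (hB1.comp (by fun_prop)).mul ((hw k).comp hτ)
  have hΦm : Measurable Φ := (hA1.comp measurable_fst).mul (Measurable.tsum hterm)
  have hτs : Measurable (scaledTimes f X Z T) := by
    have := hτ.comp (hX.prodMk h.measurable_markedPoints)
    simpa only [Function.comp_def, tau_markedPoints] using this
  -- On `K = k` the output is `Z k`, so the event splits into the pieces `E k ∩ K ⁻¹' {k}`. Each `E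
  -- k` is known to the encoder, so `hrule` applies to it.
  set E : ℕ → Set Ω := fun k => X ⁻¹' A ∩ Z k ⁻¹' B with hE
  have hEm : ∀ k, MeasurableSet (E k) := fun k => (hX hA).inter (h.sample.measurable k hB)
  have hED : ∀ k,
      MeasurableSet[MeasurableSpace.comap (encoderData X Z T) inferInstance] (E k) := by
    intro k
    exact ⟨{d | d.1 ∈ A ∧ d.2.1 k ∈ B}, (measurable_fst hA).inter
      ((by fun_prop : Measurable fun d : 𝒳 × (ℕ → 𝒵) × (ℕ → ℝ) => d.2.1 k) hB), rfl⟩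
  calc μ.map (fun ω => (X ω, decoderOutput Z K ω)) (A ×ˢ B)
      = μ (⋃ k, (E k ∩ K ⁻¹' {k})) := by
        rw [Measure.map_apply (hX.prodMk hY) (hA.prod hB)]
        congr 1
        ext ω
        simp [hE, decoderOutput]
    _ = ∑' k, μ (E k ∩ K ⁻¹' {k}) := by
        refine measure_iUnion (fun i j hij => ?_) fun k =>
          (hEm k).inter (hK (measurableSet_singleton k))
        refine Set.disjoint_left.2 fun ω hi hj => hij ?_
        exact (show K ω = i from hi.2).symm.trans hj.2
    _ = ∑' k, ∫⁻ ω in E k, w (scaledTimes f X Z T ω) k ∂μ :=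
        tsum_congr fun k => hrule k _ (hED k)
    _ = ∫⁻ ω, ∑' k, (E k).indicator (fun ω => w (scaledTimes f X Z T ω) k) ω ∂μ := by
        have hwτ : ∀ k, Measurable fun ω => w (scaledTimes f X Z T ω) k := fun k => (hw k).comp hτs
        rw [lintegral_tsum fun k => ((hwτ k).indicator (hEm k)).aemeasurable]
        exact tsum_congr fun k => (lintegral_indicator (hEm k) _).symm
    _ = ∫⁻ ω, Φ (X ω, markedPoints Z T ω) ∂μ := by
        refine lintegral_congr fun ω => ?_
        simp only [hΦ, tau_markedPoints]
        rw [← ENNReal.tsum_mul_left]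
        refine tsum_congr fun k => ?_
        by_cases h1 : X ω ∈ A <;> by_cases h2 : Z k ω ∈ B <;>
          simp [hE, Set.indicator, markedPoints, h1, h2]
    _ = ∫⁻ ω, ∫⁻ p, Φ (X ω, p) ∂(markedLaw Q) ∂μ := h.lintegral_eq hΦm
    _ = ∫⁻ ω, A.indicator (fun x => κ x B) (X ω) ∂μ := by
        refine lintegral_congr_ae ?_
        filter_upwards [hsim B hB] with ω hω
        have hmp : Measurable fun p : (ℕ → 𝒵) × (ℕ → ℝ) =>
            ∑' k, B.indicator (1 : 𝒵 → ℝ≥0∞) (p.1 k) * w (tau (f (X ω)) p) k :=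
          Measurable.tsum fun k => (hterm k).comp measurable_prodMk_left
        simp only [hΦ]
        rw [lintegral_const_mul _ hmp, hω]
        by_cases h1 : X ω ∈ A <;> simp [h1]
    _ = ((μ.map X) ⊗ₘ κ) (A ×ˢ B) := by
        rw [Measure.compProd_apply_prod hA hB, ← lintegral_indicator hA,
          lintegral_map ((κ.measurable_coe hB).indicator hA) hX]

end Source

/-! ### The selection rules as weights -/

section Source

variable {Ω 𝒳 𝒵 : Type*} [MeasurableSpace Ω] [MeasurableSpace 𝒳] [MeasurableSpace 𝒵]
  {μ : Measure Ω} {Q : Measure 𝒵} {X : Ω → 𝒳} {Z : ℕ → Ω → 𝒵} {T : ℕ → Ω → ℝ} {f : 𝒳 → 𝒵 → ℝ≥0∞}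

/-- The conditional probability is integrated over `E`; weights bounded by 1 keep both sides finite,
so the real identity lifts to `ℝ≥0∞`. -/
theorem IsSelectedIndex.measure_inter_of_ne_top [IsProbabilityMeasure μ] {α : ℝ≥0∞} (hα : α ≠ ∞)
    (h : IsSource Q X Z T μ) (hf : Measurable (Function.uncurry f)) {K : Ω → ℕ}
    (hsel : IsSelectedIndex α (encoderData X Z T) (scaledTimes f X Z T) K μ) (k : ℕ) {E : Set Ω}
    (hE : MeasurableSet[MeasurableSpace.comap (encoderData X Z T) inferInstance] E) :
    μ (E ∩ K ⁻¹' {k}) = ∫⁻ ω in E, selectionProb α.toReal (scaledTimes f X Z T ω) k ∂μ := by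
  have hle : MeasurableSpace.comap (encoderData X Z T) inferInstance ≤ ‹MeasurableSpace Ω› :=
    h.measurable_encoderData.comap_le
  have hKm : MeasurableSet (K ⁻¹' {k}) := hsel.measurable (measurableSet_singleton k)
  have hτs : Measurable (scaledTimes f X Z T) := by
    have := (measurable_tau_prod hf).comp (h.measurable_data.prodMk h.measurable_markedPoints)
    simpa only [Function.comp_def, tau_markedPoints] using this
  have hint : Integrable ((K ⁻¹' {k}).indicator fun _ => (1 : ℝ)) μ :=
    (integrable_const 1).indicator hKm
  have hsp : Measurable fun ω => selectionProb α.toReal (scaledTimes f X Z T ω) k :=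
    (measurable_selectionProb _ k).comp hτs
  have h1 := setIntegral_condExp hle hint hE
  rw [setIntegral_congr_ae (g := fun ω => (selectionProb α.toReal (scaledTimes f X Z T ω) k).toReal)
    (hle E hE) ((hsel.finite_rule hα k).mono fun _ hx _ => hx), integral_toReal
    hsp.aemeasurable (Filter.Eventually.of_forall fun ω =>
      (selectionProb_le_one _ _ _).trans_lt ENNReal.one_lt_top), setIntegral_indicator hKm] at h1
  simp only [integral_const, smul_eq_mul, mul_one, measureReal_def, Measure.restrict_apply_univ]
    at h1
  refine ((ENNReal.toReal_eq_toReal_iff' ?_ (measure_ne_top _ _)).1 h1).symm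
  refine ne_top_of_le_ne_top (measure_ne_top μ E) ?_
  refine (lintegral_mono fun ω => selectionProb_le_one _ _ _).trans ?_
  simp

theorem IsSelectedIndex.measure_inter_top [IsProbabilityMeasure μ]
    (huniq : ∀ᵐ ω ∂μ, ∃! k, IsArgmin (scaledTimes f X Z T ω) k) {K : Ω → ℕ}
    (hsel : IsSelectedIndex ∞ (encoderData X Z T) (scaledTimes f X Z T) K μ) (k : ℕ) (E : Set Ω) :
    μ (E ∩ K ⁻¹' {k}) =
      ∫⁻ ω in E, {j | IsArgmin (scaledTimes f X Z T ω) j}.indicator 1 k ∂μ := by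
  have hKm : MeasurableSet (K ⁻¹' {k}) := hsel.measurable (measurableSet_singleton k)
  rw [Set.inter_comm, ← Measure.restrict_apply hKm, ← lintegral_indicator_one hKm]
  refine lintegral_congr_ae (ae_restrict_of_ae ?_)
  filter_upwards [huniq, hsel.top_rule rfl] with ω hω hK
  by_cases h : K ω = k
  · subst h
    rw [Set.indicator_of_mem (by rfl), Set.indicator_of_mem (by exact hK)]
    rfl
  · rw [Set.indicator_of_notMem (by exact h),
      Set.indicator_of_notMem (fun hk : IsArgmin _ k => h (hω.unique hK hk))]

theorem lintegral_indicator_mul_density {κ : Kernel 𝒳 𝒵} [IsMarkovKernel κ] [IsProbabilityMeasure Q]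
    {x : 𝒳} (hac : κ x ≪ Q) (hfQ : f x =ᵐ[Q] (κ x).rnDeriv Q) {B : Set 𝒵} (hB : MeasurableSet B) :
    ∫⁻ z, B.indicator 1 z * f x z ∂Q = κ x B := by
  rw [← Measure.setLIntegral_rnDeriv' hac hB, ← lintegral_indicator hB]
  refine lintegral_congr_ae ?_
  filter_upwards [hfQ] with z hz
  by_cases h : z ∈ B <;> simp [h, hz]

end Source

end PPR

theorem mainTheorem3 {Ω 𝒳 𝒵 : Type*} [MeasurableSpace Ω] [MeasurableSpace 𝒳] [MeasurableSpace 𝒵]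
    (μ : Measure Ω) [IsProbabilityMeasure μ]
    (α : ℝ≥0∞) (hα : 1 < α)
    (Q : Measure 𝒵) [IsProbabilityMeasure Q]
    (κ : Kernel 𝒳 𝒵) [IsMarkovKernel κ]
    (X : Ω → 𝒳) (Z : ℕ → Ω → 𝒵) (T : ℕ → Ω → ℝ)
    (hsource : PPR.IsSource Q X Z T μ)
    (hac : ∀ᵐ ω ∂μ, κ (X ω) ≪ Q)
    (f : 𝒳 → 𝒵 → ℝ≥0∞) (hf : Measurable (Function.uncurry f))
    (hfQ : ∀ᵐ ω ∂μ, f (X ω) =ᵐ[Q] (κ (X ω)).rnDeriv Q) :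
    -- the selection rule is almost surely well defined
    (α ≠ ∞ → ∀ᵐ ω ∂μ,
      0 < PPR.normalizer α.toReal (PPR.scaledTimes f X Z T ω) ∧
        PPR.normalizer α.toReal (PPR.scaledTimes f X Z T ω) < ∞) ∧
    (α = ∞ → ∀ᵐ ω ∂μ, ∃! k, PPR.IsArgmin (PPR.scaledTimes f X Z T ω) k) ∧
    -- the decoder output follows the mechanism exactly
    ∀ K : Ω → ℕ,
      PPR.IsSelectedIndex α (PPR.encoderData X Z T) (PPR.scaledTimes f X Z T) K μ →
        HasCondDistrib (PPR.decoderOutput Z K) X κ μ ∧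
        ∀ x : 𝒳, (∀ᵐ ω ∂μ, X ω = x) → HasLaw (PPR.decoderOutput Z K) (κ x) μ := by
  have hfx : ∀ x, Measurable (f x) := fun x => hf.comp measurable_prodMk_left
  have hdens : ∀ᵐ ω ∂μ, ∀ B, MeasurableSet B →
      ∫⁻ z, B.indicator 1 z * f (X ω) z ∂Q = κ (X ω) B := by
    filter_upwards [hac, hfQ] with ω h1 h2 B hB
    exact PPR.lintegral_indicator_mul_density h1 h2 hB
  have hone : ∀ᵐ ω ∂μ, ∫⁻ z, f (X ω) z ∂Q = 1 := by
    filter_upwards [hdens] with ω hω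
    simpa using hω Set.univ MeasurableSet.univ
  have ha : α ≠ ∞ → 1 < α.toReal := fun h => by
    simpa using (ENNReal.toReal_lt_toReal ENNReal.one_ne_top h).2 hα
  have hτ := PPR.measurable_tau_prod hf
  have huniq : ∀ᵐ ω ∂μ, ∃! k, PPR.IsArgmin (PPR.scaledTimes f X Z T ω) k := by
    have h := hsource.ae_of_ae (hτ PPR.measurableSet_existsUnique_isArgmin) (by
      filter_upwards [hone] with ω hω
      filter_upwards [PPR.ae_markedLaw_existsUnique_isArgmin (hfx _) hω] with p ⟨k, hk, hlt⟩
      refine ⟨k, hk, fun j hj => ?_⟩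
      by_contra hne
      exact absurd (hj k) (not_le.2 (hlt j hne)))
    filter_upwards [h] with ω hω
    rw [← PPR.tau_markedPoints]
    exact hω
  refine ⟨fun h => ?_, fun _ => huniq, fun K hK => ?_⟩
  · have hm := PPR.measurable_normalizer α.toReal
    have h := hsource.ae_of_ae (hτ (hm measurableSet_Ioo : MeasurableSet
      (PPR.normalizer α.toReal ⁻¹' Set.Ioo 0 ∞))) (by
        filter_upwards [hone] with ω hω
        filter_upwards [PPR.ae_markedLaw_normalizer_ne_zero (hfx _) hω (ha h),
          PPR.ae_markedLaw_normalizer_ne_top (hfx _) hω (ha h)] with p h0 h1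
        exact ⟨pos_iff_ne_zero.2 h0, lt_top_iff_ne_top.2 h1⟩)
    filter_upwards [h] with ω hω
    rw [← PPR.tau_markedPoints]
    exact hω
  · have hcond : HasCondDistrib (PPR.decoderOutput Z K) X κ μ := by
      rcases eq_or_ne α ∞ with rfl | htop
      · refine hsource.hasCondDistrib hf
          (w := fun τ k => {j | PPR.IsArgmin τ j}.indicator 1 k) (fun k => ?_) (fun B hB => ?_)
          hK.measurable fun k E _ => hK.measure_inter_top huniq k E
        · exact measurable_one.indicator (PPR.measurableSet_isArgmin k)
        · filter_upwards [hdens, hone] with ω hω h1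
          rw [← hω B hB]
          exact PPR.lintegral_tsum_isArgmin (hfx _) h1 (measurable_one.indicator hB)
      · refine hsource.hasCondDistrib hf (w := PPR.selectionProb α.toReal)
          (PPR.measurable_selectionProb _) (fun B hB => ?_) hK.measurable
          fun k E hE => hK.measure_inter_of_ne_top htop hsource hf k hE
        filter_upwards [hdens, hone] with ω hω h1
        rw [← hω B hB]
        exact PPR.lintegral_tsum_selectionProb (hfx _) h1 (ha htop) (measurable_one.indicator hB)
    refine ⟨hcond, fun x hx => ⟨hcond.aemeasurable_snd, ?_⟩⟩
    -- For a constant input the joint law is `dirac x ⊗ₘ κ`, whose second marginal is `κ x`.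
    have hXx : μ.map X = Measure.dirac x := by
      rw [Measure.map_congr (g := fun _ => x) hx, Measure.map_const, measure_univ, one_smul]
    have h := hcond.map_eq
    rw [hXx] at h
    have h2 := congrArg Measure.snd h
    rwa [Measure.snd_compProd, Measure.dirac_bind κ.measurable, Measure.snd_map_prodMk₀
      hcond.aemeasurable_fst] at h2
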